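/- Theorem 2. Let $X_1,X_2,\dots$ be real-valued random variables on a probability space $(\Omega,\mathcal F,P)$ (no assumption on their dependence or marginal laws), let $t_m:\mathbb R^m\to\mathbb R$, $m\ge 1$, be (Borel) statistics, $\theta\in\mathbb R$ a parameter, $\tau_m>0$ scaling factors, and write $t_n=t_n(X_1,\dots,X_n)$, $T_n=\tau_n(t_n-\theta)$ and $F_n(x)=P(T_n\le x)$. Let $b=b_n$ be block lengths with $1\le b_n<n$ for all large $n$, put $N_n=n-b+1$, and let $S_{n,\mathrm{SUB}}$ be the subsampling distribution, i.e. the empirical distribution of the $N_n$ values $\tau_b\,[t_b(X_i,\dots,X_{i+b-1})-t_n]$, $i=1,\dots,N_n$, with mean $m_{n,\mathrm{SUB}}=\int x\,dS_{n,\mathrm{SUB}}(x)$ and variance $\hat\sigma^2_{n,\mathrm{SUB}}=\int (x-m_{n,\mathrm{SUB}})^2\,dS_{n,\mathrm{SUB}}(x)$. For positive integers $k_n$ let $C_{n,k_n}(x)=P_*\big(k_n^{-1/2}\sum_{j=1}^{k_n}(Y^*_{n,j}-m_{n,\mathrm{SUB}})\le x\big)$, where, conditionally on the data, $Y^*_{n,1},\dots,Y^*_{n,k_n}$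 are iid with distribution $S_{n,\mathrm{SUB}}$ and $P_*$ is the conditional (resampling) probability. Let $\Phi$ be the standard normal distribution function and let $\sigma>0$. Suppose that $k_n\to\infty$ and that, for each $\epsilon>0$, $\int_{|x|\ge\sqrt{k_n}\,\epsilon}x^2\,dS_{n,\mathrm{SUB}}(x)\to 0$ in probability as $n\to\infty$. (i) $\sup_{x\in\mathbb R}|C_{n,k_n}(x)-\Phi(x/\sigma)|\to 0$ in probability if and only if $\hat\sigma^2_{n,\mathrm{SUB}}\to\sigma^2$ in probability, as $n\to\infty$. (ii) If $\hat\sigma^2_{n,\mathrm{SUB}}\to\sigma^2$ in probability, then $\sup_{x\in\mathbb R}|C_{n,k_n}(x)-F_n(x)|\to 0$ in probability if and only if $T_n$ converges in distribution to $N(0,\sigma^2)$; equivalently, if and only if $\sup_{x\in\mathbb R}|F_n(x)-\Phi(x/\sigma)|\to 0$. -/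

import Mathlib

open MeasureTheory ProbabilityTheory Filter Topology
open scoped ENNReal NNReal

namespace ConvSub

noncomputable section

/-- The standard normal distribution function `Φ`. -/
def stdNormalCDF (x : ℝ) : ℝ := (gaussianReal 0 1).real (Set.Iic x)

/-- The full-sample statistic `t_n(X_1, …, X_n)`, for a family `t m : ℝ^m → ℝ` of statistics. -/
def fullStat {Ω : Type*} (t : (m : ℕ) → (Fin m → ℝ) → ℝ) (X : ℕ → Ω → ℝ) (n : ℕ) (ω : Ω) : ℝ :=
  t n (fun j : Fin n => X (j + 1) ω)

/-- The block statistic `t_b(X_i, …, X_{i+b-1})`. -/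
def blockStat {Ω : Type*} (t : (m : ℕ) → (Fin m → ℝ) → ℝ) (X : ℕ → Ω → ℝ) (b i : ℕ) (ω : Ω) : ℝ :=
  t b (fun j : Fin b => X (i + j) ω)

/-- `T_n = τ_n (t_n(X_1, …, X_n) - θ)`, where `θ` is the parameter to be estimated. -/
def targetStat {Ω : Type*} (t : (m : ℕ) → (Fin m → ℝ) → ℝ) (τ : ℕ → ℝ) (θ : ℝ)
    (X : ℕ → Ω → ℝ) (n : ℕ) (ω : Ω) : ℝ :=
  τ n * (fullStat t X n ω - θ)

/-- The distribution function `F_n(x) = P(T_n ≤ x)`. -/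
def targetCDF {Ω : Type*} [MeasurableSpace Ω] (P : Measure Ω) (t : (m : ℕ) → (Fin m → ℝ) → ℝ)
    (τ : ℕ → ℝ) (θ : ℝ) (X : ℕ → Ω → ℝ) (n : ℕ) (x : ℝ) : ℝ :=
  P.real {ω | targetStat t τ θ X n ω ≤ x}

/-- The subsampling distribution (as a random probability measure, at the sample point `ω`): the
empirical distribution of `τ_b (t_b(X_i, …, X_{i+b-1}) - t_n(X_1, …, X_n))`, `i = 1, …, n - b + 1`,
with block length `b = b n`. -/
def subDist {Ω : Type*} (t : (m : ℕ) → (Fin m → ℝ) → ℝ) (τ : ℕ → ℝ) (b : ℕ → ℕ)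
    (X : ℕ → Ω → ℝ) (n : ℕ) (ω : Ω) : Measure ℝ :=
  ((n - b n + 1 : ℕ) : ℝ≥0∞)⁻¹ • ∑ i ∈ Finset.Icc 1 (n - b n + 1),
    Measure.dirac (τ (b n) * (blockStat t X (b n) i ω - fullStat t X n ω))

/-- The mean of a distribution on `ℝ`. -/
def distMean (ν : Measure ℝ) : ℝ := ∫ x, x ∂ν

/-- The variance of a distribution on `ℝ`. -/
def distVar (ν : Measure ℝ) : ℝ := ∫ x, (x - distMean ν) ^ 2 ∂ν

/-- The truncated second moment `∫_{|x| ≥ r} x² dν(x)`. -/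
def truncSecondMoment (ν : Measure ℝ) (r : ℝ) : ℝ := ∫ x in {x : ℝ | r ≤ |x|}, x ^ 2 ∂ν

/-- The law of `k^{-1/2} ∑_{j ≤ k} (Y_j - m)`, where `Y_1, …, Y_k` are iid with law `ν` and `m` is
the mean of `ν`. -/
def convLaw (ν : Measure ℝ) (k : ℕ) : Measure ℝ :=
  (Measure.pi (fun _ : Fin k => ν)).map
    (fun y : Fin k → ℝ => (1 / √(k : ℝ)) * ∑ j, (y j - distMean ν))

/-- The distribution function of `convLaw ν k`. With `ν` the subsampling distribution this is the
convolved subsampling estimator `C_{n,k}`. -/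
def convCDF (ν : Measure ℝ) (k : ℕ) (x : ℝ) : ℝ := (convLaw ν k).real (Set.Iic x)

end

end ConvSub

/-! Given the data, `C_{n,k}` is the distribution function of a normalised iid sum whose law `ν` is
finitely supported, so the dependence among the `X_i` never enters. Everything rests on a
deterministic claim about pairs `(ν_n, k_n)` under the Lindeberg condition: the uniform distance to
`Φ(·/σ)` vanishes iff the variances tend to `σ²`.

Sufficiency is Lindeberg's theorem (`tendsto_charFun_convLaw`) combined with Pólya's. For the
converse, put `s_n = √Var(ν_n)`. Chebyshev keeps `s_n` away from 0, the same theorem at arguments `t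
/ s_n` makes the standardised sum normal, and its distribution function at 1 gives `C_n(s_n) →
Φ(1)`. But `C_n(s_n)` is uniformly close to `Φ(s_n/σ)`, so `s_n/σ → 1` by strict monotonicity.

A compactness-style contradiction (`exists_delta_of_forall_seq`) turns the sequential implications
into ε-δ ones, which pass to convergence in probability by a union bound. Part (ii) is then the
triangle inequality: the random `sup|C - F_n|` and the deterministic `sup|F_n - Φ(·/σ)|` differ by
at most `sup|C - Φ(·/σ)|`. -/

namespace ConvSub

/-! ### Uniform convergence of distribution functions and weak convergence -/

/-- **Pólya's theorem**: pointwise convergence of distribution functions to a continuous one is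
uniform. -/
theorem tendsto_iSup_abs_sub_of_tendsto {ι : Type*} {l : Filter ι} {F : ι → ℝ → ℝ} {G : ℝ → ℝ}
    (hF : ∀ i, Monotone (F i)) (hF0 : ∀ i x, 0 ≤ F i x) (hF1 : ∀ i x, F i x ≤ 1)
    (hG : Monotone G) (hGc : Continuous G) (hG0 : Tendsto G atBot (𝓝 0))
    (hG1 : Tendsto G atTop (𝓝 1)) (h : ∀ x, Tendsto (fun i => F i x) l (𝓝 (G x))) :
    Tendsto (fun i => ⨆ x, |F i x - G x|) l (𝓝 0) := by
  have g0 : ∀ x, 0 ≤ G x := fun x => hG.le_of_tendsto hG0 x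
  have g1 : ∀ x, G x ≤ 1 := fun x => hG.ge_of_tendsto hG1 x
  have ivt : ∀ c : ℝ, 0 < c → c < 1 → ∃ x, G x = c := by
    intro c hc0 hc1
    obtain ⟨a, ha⟩ := (hG0.eventually_lt_const hc0).exists
    obtain ⟨b, hb⟩ := (hG1.eventually_const_lt hc1).exists
    exact mem_range_of_exists_le_of_exists_ge hGc ⟨a, ha.le⟩ ⟨b, hb.le⟩
  have key : ∀ ε > 0, ∀ᶠ i in l, ⨆ x, |F i x - G x| ≤ ε := by
    intro ε hε
    -- Compare on the quantile grid `G (p j) = j / N`. Moving to a grid point and replacing `F` by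
    -- `G` there costs at most `3 / N` in total.
    obtain ⟨N, hN⟩ := exists_nat_gt (3 / ε)
    have hN0 : (0 : ℝ) < N := lt_trans (by positivity) hN
    have hNε : 3 / (N : ℝ) ≤ ε := by
      rw [div_lt_iff₀ hε] at hN
      rw [div_le_iff₀ hN0]
      linarith
    have hex : ∀ j : ℕ, ∃ x, 0 < j → j < N → G x = j / N := by
      intro j
      by_cases hj : 0 < j ∧ j < N
      · obtain ⟨x, hx⟩ := ivt (j / N) (div_pos (by exact_mod_cast hj.1) hN0)
          ((div_lt_one hN0).2 (by exact_mod_cast hj.2))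
        exact ⟨x, fun _ _ => hx⟩
      · exact ⟨0, fun h1 h2 => absurd ⟨h1, h2⟩ hj⟩
    choose p hp using hex
    have hev : ∀ᶠ i in l, ∀ j ∈ Finset.range N, |F i (p j) - G (p j)| < 1 / N := by
      rw [Filter.eventually_all_finset]
      intro j _
      have := (tendsto_sub_nhds_zero_iff.2 (h (p j))).abs
      rw [abs_zero] at this
      exact this.eventually_lt_const (by positivity)
    filter_upwards [hev] with i hi
    refine ciSup_le fun x => le_trans ?_ hNε
    obtain ⟨q, hq⟩ : ∃ q : ℕ, q = ⌊N * G x⌋₊ := ⟨_, rfl⟩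
    have hq1 : (q : ℝ) ≤ N * G x := hq ▸ Nat.floor_le (mul_nonneg hN0.le (g0 x))
    have hq2 : N * G x < q + 1 := hq ▸ Nat.lt_floor_add_one _
    have upper : N * F i x ≤ N * G x + 3 := by
      by_cases hc : q + 1 < N
      · have e := hp (q + 1) (Nat.succ_pos _) hc
        have e' : N * G (p (q + 1)) = q + 1 := by rw [e]; push_cast; field_simp
        have hx : x ≤ p (q + 1) := by
          by_contra hcon
          have := mul_le_mul_of_nonneg_left (hG (not_le.1 hcon).le) hN0.le
          linarith
        have h1 := hi (q + 1) (Finset.mem_range.2 hc)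
        rw [abs_lt, lt_div_iff₀ hN0] at h1
        have h2 := mul_le_mul_of_nonneg_left (hF i hx) hN0.le
        nlinarith [h1.2]
      · have : (N : ℝ) ≤ q + 1 := by exact_mod_cast not_lt.1 hc
        nlinarith [hF1 i x]
    -- The grid point `q - 1` is used rather than `q`: `G` may be flat, and only a strict inequality
    -- of `G`-values locates the point to the left of `x`.
    have lower : N * G x - 3 ≤ N * F i x := by
      by_cases hc : 2 ≤ q
      · obtain ⟨r, rfl⟩ := Nat.exists_eq_add_of_le' hc
        push_cast at hq1 hq2
        have hqN : r + 1 < N := by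
          have : (r : ℝ) + 2 ≤ N := hq1.trans (by nlinarith [g1 x])
          have : r + 2 ≤ N := by exact_mod_cast this
          omega
        have e := hp (r + 1) (Nat.succ_pos _) hqN
        have e' : N * G (p (r + 1)) = r + 1 := by rw [e]; push_cast; field_simp
        have hx : p (r + 1) ≤ x := by
          by_contra hcon
          have := mul_le_mul_of_nonneg_left (hG (not_le.1 hcon).le) hN0.le
          linarith
        have h1 := hi (r + 1) (Finset.mem_range.2 hqN)
        have h2 := mul_le_mul_of_nonneg_left (hF i hx) hN0.le
        have h3 := (abs_lt.1 h1).1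
        have h4 := mul_lt_mul_of_pos_left h3 hN0
        have h5 : (N : ℝ) * -(1 / N) = -1 := by field_simp
        nlinarith
      · have : (q : ℝ) ≤ 1 := by exact_mod_cast (by omega : q ≤ 1)
        nlinarith [mul_nonneg hN0.le (hF0 i x)]
    rw [abs_le, le_div_iff₀ hN0]
    constructor
    · rw [neg_le, le_div_iff₀ hN0]; linarith
    · linarith
  rw [Metric.tendsto_nhds]
  intro ε hε
  filter_upwards [key (ε / 2) (half_pos hε)] with i hi
  rw [Real.dist_eq, sub_zero, abs_of_nonneg (Real.iSup_nonneg fun x => abs_nonneg _)]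
  linarith

theorem bddAbove_range_abs_sub {F G : ℝ → ℝ} (hF0 : ∀ x, 0 ≤ F x) (hF1 : ∀ x, F x ≤ 1)
    (hG0 : ∀ x, 0 ≤ G x) (hG1 : ∀ x, G x ≤ 1) : BddAbove (Set.range fun x => |F x - G x|) := by
  refine ⟨1, ?_⟩
  rintro _ ⟨x, rfl⟩
  rw [abs_le]
  constructor <;> linarith [hF0 x, hF1 x, hG0 x, hG1 x]

theorem monotone_measureReal_Iic (μ : Measure ℝ) [IsFiniteMeasure μ] :
    Monotone fun x => μ.real (Set.Iic x) :=
  fun _ _ h => measureReal_mono (Set.Iic_subset_Iic.2 h)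

theorem continuous_measureReal_Iic (μ : Measure ℝ) [IsProbabilityMeasure μ] [NullSingletonClass μ] :
    Continuous fun x => μ.real (Set.Iic x) := by
  have e : (fun x => μ.real (Set.Iic x)) = cdf μ := by ext x; rw [cdf_eq_real]
  rw [e, continuous_iff_continuousAt]
  intro x
  rw [(monotone_cdf μ).continuousAt_iff_leftLim_eq_rightLim, (cdf μ).rightLim_eq]
  have h := (cdf μ).measure_singleton x
  rw [measure_cdf, measure_singleton] at h
  have h' := ENNReal.ofReal_eq_zero.1 h.symm
  have := (monotone_cdf μ).leftLim_le (le_refl x)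
  linarith

theorem tendsto_measureReal_Iic {μ : ℕ → ProbabilityMeasure ℝ} {ν : ProbabilityMeasure ℝ}
    (hν : NullSingletonClass (ν : Measure ℝ)) (h : Tendsto μ atTop (𝓝 ν)) (x : ℝ) :
    Tendsto (fun n => (μ n : Measure ℝ).real (Set.Iic x)) atTop
      (𝓝 ((ν : Measure ℝ).real (Set.Iic x))) :=
  (ENNReal.tendsto_toReal (measure_ne_top _ _)).comp
    (ProbabilityMeasure.tendsto_measure_of_null_frontier_of_tendsto' h
      (by rw [frontier_Iic]; exact measure_singleton x))

/-- Weak convergence to a limit without atoms is uniform convergence of distribution functions. -/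
theorem tendsto_iff_tendsto_iSup_measureReal_Iic {μ : ℕ → ProbabilityMeasure ℝ}
    {ν : ProbabilityMeasure ℝ} (hν : NullSingletonClass (ν : Measure ℝ)) :
    Tendsto μ atTop (𝓝 ν) ↔
      Tendsto (fun n => ⨆ x, |(μ n : Measure ℝ).real (Set.Iic x)
        - (ν : Measure ℝ).real (Set.Iic x)|) atTop (𝓝 0) := by
  constructor
  · intro h
    refine tendsto_iSup_abs_sub_of_tendsto (fun i => monotone_measureReal_Iic _)
      (fun _ _ => measureReal_nonneg) (fun _ _ => measureReal_le_one)
      (monotone_measureReal_Iic _) (continuous_measureReal_Iic _) ?_ ?_ ?_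
    · simpa only [← cdf_eq_real] using tendsto_cdf_atBot (ν : Measure ℝ)
    · simpa only [← cdf_eq_real] using tendsto_cdf_atTop (ν : Measure ℝ)
    · exact tendsto_measureReal_Iic hν h
  · intro h
    have hp : ∀ x, Tendsto (fun n => (μ n : Measure ℝ).real (Set.Iic x)) atTop
        (𝓝 ((ν : Measure ℝ).real (Set.Iic x))) := by
      intro x
      rw [tendsto_iff_dist_tendsto_zero]
      refine squeeze_zero (fun _ => dist_nonneg) (fun n => ?_) h
      exact le_ciSup (f := fun x => |(μ n : Measure ℝ).real (Set.Iic x)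
        - (ν : Measure ℝ).real (Set.Iic x)|) (bddAbove_range_abs_sub
        (fun _ => measureReal_nonneg) (fun _ => measureReal_le_one)
        (fun _ => measureReal_nonneg) (fun _ => measureReal_le_one)) x
    have hIoc : ∀ (ρ : ProbabilityMeasure ℝ) (a b : ℝ), a < b →
        (ρ : Measure ℝ).real (Set.Ioc a b)
          = (ρ : Measure ℝ).real (Set.Iic b) - (ρ : Measure ℝ).real (Set.Iic a) := by
      intro ρ a b hab
      rw [← Set.Iic_sdiff_Iic, measureReal_sdiff (Set.Iic_subset_Iic.2 hab.le) measurableSet_Iic]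
    -- Half-open intervals form a π-system containing a small neighbourhood of each point inside any
    -- open set, so convergence of their masses forces weak convergence.
    refine (isPiSystem_Ioc (id : ℝ → ℝ) id).tendsto_probabilityMeasure_of_tendsto_of_mem ?_ ?_ ?_
    · rintro _ ⟨a, b, -, rfl⟩
      exact measurableSet_Ioc
    · intro u hu x hx
      obtain ⟨ε, hε, hball⟩ := Metric.isOpen_iff.1 hu x hx
      refine ⟨Set.Ioc (x - ε / 2) (x + ε / 2), ⟨_, _, ?_, rfl⟩, Ioc_mem_nhds ?_ ?_, ?_⟩
      · simp only [id]; linarith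
      · linarith
      · linarith
      · intro y hy
        apply hball
        rw [Metric.mem_ball, Real.dist_eq, abs_lt]
        constructor <;> linarith [hy.1, hy.2]
    · rintro _ ⟨a, b, hab, rfl⟩
      rw [← NNReal.tendsto_coe]
      have := (hp b).sub (hp a)
      simp only [← hIoc _ a b hab] at this
      exact this


/-! ### Taylor bounds for characteristic functions -/

theorem norm_exp_mul_I_sub_le_of_abs_le_one {y : ℝ} (hy : |y| ≤ 1) :
    ‖Complex.exp (y * Complex.I) - (1 + y * Complex.I - y ^ 2 / 2)‖ ≤ |y| ^ 3 := by
  have hn : ‖(y * Complex.I : ℂ)‖ = |y| := by simp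
  have h := Complex.exp_bound (x := y * Complex.I) (by rwa [hn]) (n := 3) (by norm_num)
  rw [hn] at h
  have e : ∑ m ∈ Finset.range 3, (y * Complex.I : ℂ) ^ m / (m.factorial : ℂ)
      = 1 + y * Complex.I - y ^ 2 / 2 := by
    simp [Finset.sum_range_succ, mul_pow]
    ring
  rw [e] at h
  refine h.trans (mul_le_of_le_one_right (by positivity) ?_)
  norm_num [Nat.factorial]

theorem norm_exp_mul_I_sub_le_of_one_le_abs {y : ℝ} (hy : 1 ≤ |y|) :
    ‖Complex.exp (y * Complex.I) - (1 + y * Complex.I - y ^ 2 / 2)‖ ≤ 4 * y ^ 2 := by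
  have h1 : ‖Complex.exp (y * Complex.I)‖ = 1 := Complex.norm_exp_ofReal_mul_I y
  have h2 : ‖(1 + y * Complex.I - y ^ 2 / 2 : ℂ)‖ ≤ 1 + |y| + y ^ 2 / 2 := by
    refine (norm_sub_le _ _).trans (add_le_add ((norm_add_le _ _).trans ?_) ?_) <;> simp
  refine (norm_sub_le _ _).trans ?_
  rw [h1]
  nlinarith [sq_abs y]

/-- The quadratic bound serves the tail `|x| ≥ r`, where only second moments are available; the
cubic one serves `|x| < r`, where `|x|³ ≤ r x²`. -/
theorem norm_exp_mul_I_sub_le_sq (y : ℝ) :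
    ‖Complex.exp (y * Complex.I) - (1 + y * Complex.I - y ^ 2 / 2)‖ ≤ 4 * y ^ 2 := by
  rcases le_total |y| 1 with h | h
  · refine (norm_exp_mul_I_sub_le_of_abs_le_one h).trans ?_
    have := mul_le_of_le_one_left (sq_nonneg |y|) h
    have e : |y| ^ 3 = |y| * |y| ^ 2 := by ring
    rw [e, sq_abs] at *
    nlinarith [sq_nonneg y]
  · exact norm_exp_mul_I_sub_le_of_one_le_abs h

theorem norm_exp_mul_I_sub_le_cube (y : ℝ) :
    ‖Complex.exp (y * Complex.I) - (1 + y * Complex.I - y ^ 2 / 2)‖ ≤ 4 * |y| ^ 3 := by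
  rcases le_total |y| 1 with h | h
  · refine (norm_exp_mul_I_sub_le_of_abs_le_one h).trans ?_
    linarith [pow_nonneg (abs_nonneg y) 3]
  · refine (norm_exp_mul_I_sub_le_of_one_le_abs h).trans ?_
    have := mul_le_mul_of_nonneg_right h (sq_nonneg |y|)
    rw [sq_abs] at this
    have e : |y| ^ 3 = |y| * |y| ^ 2 := by ring
    rw [e, sq_abs]
    linarith

theorem integrable_sq {ν : Measure ℝ} (hν : MemLp id 2 ν) : Integrable (fun x : ℝ => x ^ 2) ν :=
  hν.integrable_sq

theorem integrable_self {ν : Measure ℝ} [IsProbabilityMeasure ν] (hν : MemLp id 2 ν) :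
    Integrable (fun x : ℝ => x) ν :=
  hν.integrable (by norm_num)

theorem measurableSet_le_abs (r : ℝ) : MeasurableSet {x : ℝ | r ≤ |x|} :=
  measurableSet_le measurable_const measurable_id.abs

theorem truncSecondMoment_eq_integral_indicator (ν : Measure ℝ) (r : ℝ) :
    truncSecondMoment ν r = ∫ x, Set.indicator {x : ℝ | r ≤ |x|} (fun x => x ^ 2) x ∂ν :=
  (integral_indicator (measurableSet_le_abs r)).symm

theorem truncSecondMoment_nonneg (ν : Measure ℝ) (r : ℝ) : 0 ≤ truncSecondMoment ν r :=
  integral_nonneg fun x => sq_nonneg x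

theorem truncSecondMoment_anti {ν : Measure ℝ} (hν : MemLp id 2 ν) {r s : ℝ} (h : r ≤ s) :
    truncSecondMoment ν s ≤ truncSecondMoment ν r :=
  setIntegral_mono_set (integrable_sq hν).integrableOn (ae_of_all _ fun x => sq_nonneg x)
    (Eventually.of_forall fun _ hx => h.trans hx)

/-- Second-order expansion of the characteristic function of a centered law, with a remainder
controlled by the truncated second moment. -/
theorem norm_charFun_sub_le {ν : Measure ℝ} [IsProbabilityMeasure ν] (hν : MemLp id 2 ν)
    (h0 : ∫ x, x ∂ν = 0) (u : ℝ) {r : ℝ} (hr : 0 ≤ r) :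
    ‖charFun ν u - ((1 - u ^ 2 / 2 * ∫ x, x ^ 2 ∂ν : ℝ) : ℂ)‖
      ≤ 4 * |u| ^ 3 * r * ∫ x, x ^ 2 ∂ν + 4 * u ^ 2 * truncSecondMoment ν r := by
  have i1 := integrable_self hν
  have i2 := integrable_sq hν
  have iexp : Integrable (fun x : ℝ => Complex.exp (u * x * Complex.I)) ν := by
    refine (integrable_const (1 : ℝ)).mono' (by fun_prop) (ae_of_all _ fun x => ?_)
    rw [← Complex.ofReal_mul, Complex.norm_exp_ofReal_mul_I]
  have i1' : Integrable (fun x : ℝ => ((x : ℝ) : ℂ) * (u * Complex.I)) ν := i1.ofReal.mul_const _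
  have i2' : Integrable (fun x : ℝ => ((x ^ 2 : ℝ) : ℂ) * (u ^ 2 / 2)) ν := i2.ofReal.mul_const _
  have ipoly : Integrable (fun x : ℝ => (1 : ℂ) + (x : ℂ) * (u * Complex.I)) ν :=
    (integrable_const 1).add i1'
  have e : charFun ν u - ((1 - u ^ 2 / 2 * ∫ x, x ^ 2 ∂ν : ℝ) : ℂ)
      = ∫ x, (Complex.exp (u * x * Complex.I)
        - ((1 + (x : ℂ) * (u * Complex.I)) - ((x ^ 2 : ℝ) : ℂ) * (u ^ 2 / 2))) ∂ν := by
    have i3 : Integrable (fun x : ℝ => (1 + (x : ℂ) * (u * Complex.I))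
        - ((x ^ 2 : ℝ) : ℂ) * (u ^ 2 / 2)) ν := ipoly.sub i2'
    rw [integral_sub iexp i3, integral_sub ipoly i2',
      integral_add (integrable_const 1) i1', integral_mul_const, integral_mul_const,
      integral_complex_ofReal, integral_complex_ofReal, h0, charFun_apply_real]
    simp
    ring
  rw [e, truncSecondMoment_eq_integral_indicator, ← integral_const_mul, ← integral_const_mul,
    ← integral_add (i2.const_mul _) ((i2.indicator (measurableSet_le_abs r)).const_mul _)]
  refine norm_integral_le_of_norm_le
    ((i2.const_mul _).add ((i2.indicator (measurableSet_le_abs r)).const_mul _))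
    (ae_of_all _ fun x => ?_)
  have e2 : Complex.exp (u * x * Complex.I)
        - ((1 + (x : ℂ) * (u * Complex.I)) - ((x ^ 2 : ℝ) : ℂ) * (u ^ 2 / 2))
      = Complex.exp ((u * x : ℝ) * Complex.I)
        - (1 + (u * x : ℝ) * Complex.I - ((u * x : ℝ) : ℂ) ^ 2 / 2) := by
    push_cast
    ring_nf
  rw [e2]
  by_cases hx : r ≤ |x|
  · rw [Set.indicator_of_mem (show x ∈ {x : ℝ | r ≤ |x|} from hx)]
    have := norm_exp_mul_I_sub_le_sq (u * x)
    have h3 : 0 ≤ 4 * |u| ^ 3 * r * x ^ 2 := by positivity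
    nlinarith
  · rw [Set.indicator_of_notMem (show x ∉ {x : ℝ | r ≤ |x|} from hx), mul_zero, add_zero]
    refine (norm_exp_mul_I_sub_le_cube (u * x)).trans ?_
    rw [abs_mul, mul_pow, ← sq_abs x]
    have h4 : |x| ^ 3 ≤ r * |x| ^ 2 := by
      have := mul_le_mul_of_nonneg_right (not_le.1 hx).le (sq_nonneg |x|)
      linarith [show |x| ^ 3 = |x| * |x| ^ 2 by ring]
    have := mul_le_mul_of_nonneg_left h4 (show 0 ≤ 4 * |u| ^ 3 by positivity)
    linarith

/-! ### Recentring and truncated moments -/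

/-- The law `ν` recentered at its mean. -/
noncomputable def centered (ν : Measure ℝ) : Measure ℝ := ν.map fun x => x - distMean ν

instance isProbabilityMeasure_centered (ν : Measure ℝ) [IsProbabilityMeasure ν] :
    IsProbabilityMeasure (centered ν) :=
  Measure.isProbabilityMeasure_map (by fun_prop)

theorem memLp_centered {ν : Measure ℝ} [IsProbabilityMeasure ν] (hν : MemLp id 2 ν) :
    MemLp id 2 (centered ν) := by
  rw [centered, memLp_map_measure_iff (by fun_prop) (by fun_prop)]
  exact hν.sub (memLp_const _)

theorem integral_centered {ν : Measure ℝ} [IsProbabilityMeasure ν] (hν : MemLp id 2 ν) :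
    ∫ x, x ∂(centered ν) = 0 := by
  rw [centered, integral_map (by fun_prop) (by fun_prop),
    integral_sub (integrable_self hν) (integrable_const _)]
  simp [distMean]

theorem integral_sq_centered (ν : Measure ℝ) :
    ∫ x, x ^ 2 ∂(centered ν) = distVar ν := by
  rw [centered, integral_map (by fun_prop) (by fun_prop), distVar]

theorem distVar_nonneg (ν : Measure ℝ) : 0 ≤ distVar ν :=
  integral_nonneg fun _ => sq_nonneg _

/-- Pointwise, `|x|` is at most `r` off the tail and `x² / r` on it. With `r` of order `√k ε` this
makes the mean negligible against `√k`, so a Lindeberg condition about the origin also controls the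
centered law. -/
theorem abs_distMean_le {ν : Measure ℝ} [IsProbabilityMeasure ν] (hν : MemLp id 2 ν) {r : ℝ}
    (hr : 0 < r) : |distMean ν| ≤ r + truncSecondMoment ν r / r := by
  have i2 := integrable_sq hν
  have ii := (i2.indicator (measurableSet_le_abs r)).div_const r
  have e : r + truncSecondMoment ν r / r
      = ∫ x, (r + Set.indicator {x : ℝ | r ≤ |x|} (fun x => x ^ 2) x / r) ∂ν := by
    rw [integral_add (integrable_const _) ii, integral_div,
      truncSecondMoment_eq_integral_indicator]
    simp
  rw [e, distMean, ← Real.norm_eq_abs]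
  refine norm_integral_le_of_norm_le ((integrable_const _).add ii) (ae_of_all _ fun x => ?_)
  rw [Real.norm_eq_abs]
  by_cases hx : r ≤ |x|
  · rw [Set.indicator_of_mem (show x ∈ {x : ℝ | r ≤ |x|} from hx)]
    have : |x| ≤ x ^ 2 / r := by
      rw [le_div_iff₀ hr, ← sq_abs]
      nlinarith [abs_nonneg x]
    linarith
  · rw [Set.indicator_of_notMem (show x ∉ {x : ℝ | r ≤ |x|} from hx)]
    simpa using (not_le.1 hx).le

/-- If `|x - m| ≥ 2r` and `|m| ≤ r`, then `|x| ≥ r ≥ |m|`, whence `|x - m| ≤ 2|x|`; squaring gives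
the factor 4. -/
theorem truncSecondMoment_centered_le {ν : Measure ℝ} [IsProbabilityMeasure ν]
    (hν : MemLp id 2 ν) {r : ℝ} (hm : |distMean ν| ≤ r) :
    truncSecondMoment (centered ν) (2 * r) ≤ 4 * truncSecondMoment ν r := by
  have i2 := integrable_sq hν
  have i2' : Integrable (fun x => (x - distMean ν) ^ 2) ν :=
    (hν.sub (memLp_const (distMean ν))).integrable_sq
  have h1 : truncSecondMoment (centered ν) (2 * r)
      = ∫ x in {x : ℝ | 2 * r ≤ |x - distMean ν|}, (x - distMean ν) ^ 2 ∂ν := by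
    rw [truncSecondMoment, centered, setIntegral_map (measurableSet_le_abs _) (by fun_prop)
      (by fun_prop)]
    rfl
  have hm2 : MeasurableSet {x : ℝ | 2 * r ≤ |x - distMean ν|} :=
    measurableSet_le measurable_const (measurable_id.sub_const _).abs
  rw [h1, truncSecondMoment_eq_integral_indicator, ← integral_indicator hm2,
    ← integral_const_mul]
  refine integral_mono (i2'.indicator hm2)
    ((i2.indicator (measurableSet_le_abs r)).const_mul _) fun x => ?_
  by_cases hx : 2 * r ≤ |x - distMean ν|
  · have hx1 : |x - distMean ν| ≤ |x| + |distMean ν| := abs_sub _ _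
    have hx2 : r ≤ |x| := by linarith
    simp only [Set.indicator, Set.mem_ofPred_eq, hx, hx2, if_true]
    rw [← sq_abs (x - _), ← sq_abs x]
    have : |x - distMean ν| ≤ 2 * |x| := by linarith
    nlinarith [abs_nonneg (x - distMean ν)]
  · simp only [Set.indicator, Set.mem_ofPred_eq, hx, if_false]
    have : 0 ≤ Set.indicator {x : ℝ | r ≤ |x|} (fun x => x ^ 2) x :=
      Set.indicator_nonneg (fun _ _ => sq_nonneg _) _
    simp only [Set.indicator, Set.mem_ofPred_eq] at this
    linarith

/-! ### Lindeberg's theorem for normalised iid sums -/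

theorem norm_pow_sub_pow_le {a b : ℂ} (ha : ‖a‖ ≤ 1) (hb : ‖b‖ ≤ 1) (k : ℕ) :
    ‖a ^ k - b ^ k‖ ≤ k * ‖a - b‖ := by
  induction k with
  | zero => simp
  | succ k ih =>
    have e : a ^ (k + 1) - b ^ (k + 1) = a ^ k * (a - b) + (a ^ k - b ^ k) * b := by ring
    rw [e]
    refine (norm_add_le _ _).trans ?_
    rw [norm_mul, norm_mul, norm_pow]
    have h1 : ‖a‖ ^ k * ‖a - b‖ ≤ ‖a - b‖ :=
      mul_le_of_le_one_left (norm_nonneg _) (pow_le_one₀ (norm_nonneg _) ha)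
    have h2 : ‖a ^ k - b ^ k‖ * ‖b‖ ≤ ‖a ^ k - b ^ k‖ :=
      mul_le_of_le_one_right (norm_nonneg _) hb
    push_cast
    linarith

theorem abs_exp_neg_sub_one_sub_le {w : ℝ} (hw : 0 ≤ w) : |(1 - w) - Real.exp (-w)| ≤ w ^ 2 := by
  rw [abs_sub_comm]
  rcases le_total w 1 with h | h
  · have := Real.abs_exp_sub_one_sub_id_le (x := -w) (by rwa [abs_neg, abs_of_nonneg hw])
    rw [neg_sq] at this
    convert this using 2
    ring
  · have h1 : Real.exp (-w) ≤ 1 := Real.exp_le_one_iff.2 (by linarith)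
    have h2 := Real.add_one_le_exp (-w)
    rw [abs_le]
    constructor <;> nlinarith

instance isProbabilityMeasure_convLaw (ν : Measure ℝ) [IsProbabilityMeasure ν] (k : ℕ) :
    IsProbabilityMeasure (convLaw ν k) :=
  Measure.isProbabilityMeasure_map
    (Measurable.const_mul (by fun_prop) _).aemeasurable

/-- Coordinatewise centering carries the product of copies of `ν` to the product of copies of
`centered ν`, so the sum's characteristic function factorises. -/
theorem charFun_convLaw (ν : Measure ℝ) [IsProbabilityMeasure ν] (k : ℕ) (t : ℝ) :
    charFun (convLaw ν k) t = charFun (centered ν) (1 / √k * t) ^ k := by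
  have hpi : (Measure.pi fun _ : Fin k => centered ν)
      = (Measure.pi fun _ : Fin k => ν).map fun y i => y i - distMean ν := by
    have := Measure.pi_map_pi (μ := fun _ : Fin k => ν)
      (f := fun _ : Fin k => fun x => x - distMean ν) (fun _ => by fun_prop)
    exact this.symm
  have h := charFun_map_sum_pi_eq_prod (fun _ : Fin k => centered ν)
  rw [hpi, Measure.map_map (by fun_prop) (by fun_prop)] at h
  have h2 := congrFun h (1 / √k * t)
  rw [convLaw, charFun_map_mul_comp (Measurable.aemeasurable (by fun_prop))]
  simpa [Function.comp_def] using h2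

/-- Quantitative normal approximation of the characteristic function of `convLaw ν k`. -/
theorem norm_charFun_convLaw_sub_le {ν : Measure ℝ} [IsProbabilityMeasure ν] (hν : MemLp id 2 ν)
    {k : ℕ} (hk : 0 < k) (t : ℝ) {ε : ℝ} (hε : 0 ≤ ε) (hm : |distMean ν| ≤ √k * ε) :
    ‖charFun (convLaw ν k) t - (Real.exp (-(t ^ 2 * distVar ν / 2)) : ℝ)‖
      ≤ 8 * |t| * ε * (t ^ 2 * distVar ν) + 16 * t ^ 2 * truncSecondMoment ν (√k * ε)
        + (t ^ 2 * distVar ν) ^ 2 / k := by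
  have hk' : (0 : ℝ) < k := by exact_mod_cast hk
  have hs : 0 < √(k : ℝ) := Real.sqrt_pos.2 hk'
  have hsq : √(k : ℝ) ^ 2 = k := Real.sq_sqrt hk'.le
  obtain ⟨s, hs_def⟩ : ∃ s, s = √(k : ℝ) := ⟨_, rfl⟩
  rw [← hs_def] at hs hsq hm ⊢
  have hV := distVar_nonneg ν
  obtain ⟨w, hw⟩ : ∃ w, w = t ^ 2 * distVar ν / 2 / k := ⟨_, rfl⟩
  have hw0 : 0 ≤ w := by rw [hw]; positivity
  have hexp : ((Real.exp (-(t ^ 2 * distVar ν / 2)) : ℝ) : ℂ) = ((Real.exp (-w) : ℝ) : ℂ) ^ k := by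
    rw [← Complex.ofReal_pow, ← Real.exp_nat_mul, hw]
    congr 2
    field_simp
  have hb : ‖((Real.exp (-w) : ℝ) : ℂ)‖ ≤ 1 := by
    rw [Complex.norm_real, Real.norm_eq_abs, Real.abs_exp]
    exact Real.exp_le_one_iff.2 (by linarith)
  rw [charFun_convLaw, hexp, ← hs_def]
  refine (norm_pow_sub_pow_le (norm_charFun_le_one _) hb k).trans ?_
  have hu2 : (1 / s * t) ^ 2 = t ^ 2 / k := by rw [← hsq]; field_simp
  have h1 := norm_charFun_sub_le (memLp_centered hν) (integral_centered hν) (1 / s * t)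
    (r := 2 * (s * ε)) (by positivity)
  rw [integral_sq_centered] at h1
  have hlin : 1 - (1 / s * t) ^ 2 / 2 * distVar ν = 1 - w := by
    rw [hu2, hw]; field_simp
  rw [hlin] at h1
  have h2 : ‖((1 - w : ℝ) : ℂ) - ((Real.exp (-w) : ℝ) : ℂ)‖ ≤ w ^ 2 := by
    rw [← Complex.ofReal_sub, Complex.norm_real]
    exact abs_exp_neg_sub_one_sub_le hw0
  have h3 := truncSecondMoment_centered_le hν hm
  have h4 : ‖charFun (centered ν) (1 / s * t) - ((Real.exp (-w) : ℝ) : ℂ)‖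
      ≤ (4 * |1 / s * t| ^ 3 * (2 * (s * ε)) * distVar ν
        + 4 * (1 / s * t) ^ 2 * (4 * truncSecondMoment ν (s * ε))) + w ^ 2 := by
    refine (norm_sub_le_norm_sub_add_norm_sub _ ((1 - w : ℝ) : ℂ) _).trans (add_le_add
      (h1.trans ?_) h2)
    gcongr
  refine (mul_le_mul_of_nonneg_left h4 hk'.le).trans ?_
  -- The cubic term is of order `k^{-3/2}`; the truncation level restores `√k`, and the factor `k`
  -- from comparing powers cancels the rest, leaving a multiple of `ε`.
  have hu3 : |1 / s * t| ^ 3 * s = |t| * t ^ 2 / k := by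
    rw [abs_mul, abs_of_pos (by positivity : 0 < 1 / s), ← sq_abs t, ← hsq]
    field_simp
  have e : (k : ℝ) * ((4 * |1 / s * t| ^ 3 * (2 * (s * ε)) * distVar ν
        + 4 * (1 / s * t) ^ 2 * (4 * truncSecondMoment ν (s * ε))) + w ^ 2)
      = k * (8 * (|1 / s * t| ^ 3 * s) * ε * distVar ν)
        + k * (16 * (1 / s * t) ^ 2 * truncSecondMoment ν (s * ε)) + k * w ^ 2 := by ring
  rw [e, hu3, hu2]
  have e1 : (k : ℝ) * (8 * (|t| * t ^ 2 / k) * ε * distVar ν)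
      = 8 * |t| * ε * (t ^ 2 * distVar ν) := by field_simp
  have e2 : (k : ℝ) * (16 * (t ^ 2 / k) * truncSecondMoment ν (s * ε))
      = 16 * t ^ 2 * truncSecondMoment ν (s * ε) := by field_simp
  have e3 : (k : ℝ) * w ^ 2 = (t ^ 2 * distVar ν) ^ 2 / k / 4 := by rw [hw]; field_simp; ring
  rw [e1, e2, e3]
  have : 0 ≤ (t ^ 2 * distVar ν) ^ 2 / k := by positivity
  linarith


/-- **Lindeberg's central limit theorem** for `convLaw`, on the level of characteristic functions,
allowing for arguments that vary with the sequence. -/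
theorem tendsto_charFun_convLaw {ν : ℕ → Measure ℝ} [∀ n, IsProbabilityMeasure (ν n)]
    (hν : ∀ n, MemLp id 2 (ν n)) {k : ℕ → ℕ} (hk_pos : ∀ n, 0 < k n) (hk : Tendsto k atTop atTop)
    (htr : ∀ ε : ℝ, 0 < ε →
      Tendsto (fun n => truncSecondMoment (ν n) (√(k n : ℝ) * ε)) atTop (𝓝 0))
    {t : ℕ → ℝ} {T v : ℝ} (ht : ∀ᶠ n in atTop, |t n| ≤ T)
    (hv : Tendsto (fun n => t n ^ 2 * distVar (ν n)) atTop (𝓝 v)) :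
    Tendsto (fun n => charFun (convLaw (ν n) (k n)) (t n)) atTop
      (𝓝 ((Real.exp (-(v / 2)) : ℝ) : ℂ)) := by
  have hv0 : 0 ≤ v := ge_of_tendsto' hv fun n => mul_nonneg (sq_nonneg _) (distVar_nonneg _)
  obtain ⟨n₀, hn₀⟩ := ht.exists
  have hT0 : 0 ≤ T := (abs_nonneg _).trans hn₀
  have hlim : Tendsto (fun n => ((Real.exp (-(t n ^ 2 * distVar (ν n) / 2)) : ℝ) : ℂ)) atTop
      (𝓝 ((Real.exp (-(v / 2)) : ℝ) : ℂ)) :=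
    (Complex.continuous_ofReal.tendsto _).comp
      ((Real.continuous_exp.tendsto _).comp (hv.div_const 2).neg)
  suffices h : Tendsto (fun n => charFun (convLaw (ν n) (k n)) (t n)
      - ((Real.exp (-(t n ^ 2 * distVar (ν n) / 2)) : ℝ) : ℂ)) atTop (𝓝 0) by
    simpa using h.add hlim
  rw [Metric.tendsto_nhds]
  intro η hη
  -- Only the cubic error survives in the limit, so `ε` is tuned to it; the `+ 1` below covers `T *
  -- v = 0`.
  obtain ⟨ε, hε, hεη⟩ : ∃ ε > 0, 8 * T * ε * v < η := by
    refine ⟨η / (8 * T * v + 1), by positivity, ?_⟩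
    rw [show 8 * T * (η / (8 * T * v + 1)) * v = 8 * T * v * η / (8 * T * v + 1) by ring,
      div_lt_iff₀ (by positivity)]
    nlinarith
  have hB : Tendsto (fun n => 8 * T * ε * (t n ^ 2 * distVar (ν n))
      + 16 * T ^ 2 * truncSecondMoment (ν n) (√(k n : ℝ) * ε)
      + (t n ^ 2 * distVar (ν n)) ^ 2 / (k n : ℝ)) atTop (𝓝 (8 * T * ε * v)) := by
    have h3 : Tendsto (fun n => (t n ^ 2 * distVar (ν n)) ^ 2 / (k n : ℝ)) atTop (𝓝 0) :=
      (hv.pow 2).div_atTop (tendsto_natCast_atTop_atTop.comp hk)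
    simpa using ((hv.const_mul (8 * T * ε)).add ((htr ε hε).const_mul (16 * T ^ 2))).add h3
  filter_upwards [ht, hB.eventually_lt_const hεη,
    (htr (ε / 2) (half_pos hε)).eventually_lt_const (show 0 < (ε / 2) ^ 2 by positivity)]
    with n h1 h2 h3
  have hk1 : (1 : ℝ) ≤ k n := by exact_mod_cast hk_pos n
  have hs : 0 < √(k n : ℝ) := Real.sqrt_pos.2 (by linarith)
  have hm : |distMean (ν n)| ≤ √(k n : ℝ) * ε := by
    -- Half the level is used so that both terms of the mean bound are at most `√k ε / 2`; the
    -- second needs `k ≥ 1`.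
    have hr : 0 < √(k n : ℝ) * (ε / 2) := by positivity
    refine (abs_distMean_le (hν n) hr).trans ?_
    have : truncSecondMoment (ν n) (√(k n : ℝ) * (ε / 2)) / (√(k n : ℝ) * (ε / 2))
        ≤ √(k n : ℝ) * (ε / 2) := by
      rw [div_le_iff₀ hr, ← sq, mul_pow, Real.sq_sqrt (by linarith)]
      nlinarith [sq_nonneg (ε / 2)]
    linarith
  rw [dist_zero_right]
  refine (norm_charFun_convLaw_sub_le (hν n) (hk_pos n) (t n) hε.le hm).trans_lt
    (lt_of_le_of_lt ?_ h2)
  have hV := distVar_nonneg (ν n)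
  have htr0 := truncSecondMoment_nonneg (ν n) (√(k n : ℝ) * ε)
  have hT2 : t n ^ 2 ≤ T ^ 2 := by rw [← sq_abs]; gcongr
  gcongr

/-- **Chebyshev's inequality** for `convLaw`. -/
theorem one_sub_convCDF_one_le {ν : Measure ℝ} [IsProbabilityMeasure ν] (hν : MemLp id 2 ν)
    {k : ℕ} (hk : 0 < k) : 1 - convCDF ν k 1 ≤ distVar ν := by
  have hk' : (0 : ℝ) < k := by exact_mod_cast hk
  have hX : MemLp (fun x : ℝ => x - distMean ν) 2 ν := hν.sub (memLp_const _)
  have hXi : ∀ i : Fin k, MemLp (fun y : Fin k → ℝ => y i - distMean ν) 2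
      (Measure.pi fun _ : Fin k => ν) := fun i =>
    hX.comp_measurePreserving (measurePreserving_eval (fun _ : Fin k => ν) i)
  have hS : MemLp (fun y : Fin k → ℝ => 1 / √(k : ℝ) * ∑ j, (y j - distMean ν)) 2
      (Measure.pi fun _ : Fin k => ν) :=
    (memLp_finsetSum _ fun i _ => hXi i).const_mul _
  have hvar1 : Var[fun x : ℝ => x - distMean ν; ν] = distVar ν := by
    rw [variance_eq_integral (by fun_prop), integral_sub (integrable_self hν) (integrable_const _)]
    simp [distVar, distMean]
  have hvar : Var[fun y : Fin k → ℝ => 1 / √(k : ℝ) * ∑ j, (y j - distMean ν);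
      Measure.pi fun _ : Fin k => ν] = distVar ν := by
    have h := variance_sum_pi (μ := fun _ : Fin k => ν)
      (X := fun _ : Fin k => fun x : ℝ => x - distMean ν) (fun _ => hX)
    have e : (∑ i : Fin k, fun y : Fin k → ℝ => y i - distMean ν)
        = fun y : Fin k → ℝ => ∑ j, (y j - distMean ν) := by ext; simp
    rw [variance_const_mul, ← e, h]
    simp only [hvar1, Finset.sum_const, Finset.card_univ, Fintype.card_fin, nsmul_eq_mul]
    rw [div_pow, Real.sq_sqrt hk'.le]
    field_simp
  have hmean : ∫ y : Fin k → ℝ, 1 / √(k : ℝ) * ∑ j, (y j - distMean ν)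
      ∂(Measure.pi fun _ : Fin k => ν) = 0 := by
    rw [integral_const_mul, integral_finsetSum _ fun i _ => (hXi i).integrable (by norm_num)]
    have : ∀ i : Fin k, ∫ y : Fin k → ℝ, y i - distMean ν ∂(Measure.pi fun _ : Fin k => ν) = 0 := by
      intro i
      rw [integral_comp_eval (μ := fun _ : Fin k => ν) (i := i) (f := fun x => x - distMean ν)
        (by fun_prop), integral_sub (integrable_self hν) (integrable_const _)]
      simp [distMean]
    simp [this]
  have hch := meas_ge_le_variance_div_sq hS (c := 1) one_pos
  rw [hmean, hvar] at hch
  have hmeas : Measurable fun y : Fin k → ℝ => 1 / √(k : ℝ) * ∑ j, (y j - distMean ν) :=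
    Measurable.const_mul (by fun_prop) _
  rw [convCDF, ← probReal_compl_eq_one_sub measurableSet_Iic, Set.compl_Iic, convLaw,
    map_measureReal_apply hmeas measurableSet_Ioi]
  refine ENNReal.toReal_le_of_le_ofReal (distVar_nonneg _) ((measure_mono ?_).trans
    (hch.trans_eq (by simp)))
  intro y hy
  have hy' : 1 < 1 / √(k : ℝ) * ∑ j, (y j - distMean ν) := hy
  simp only [Set.mem_ofPred_eq, sub_zero]
  exact hy'.le.trans (le_abs_self _)

/-! ### Normal limit if and only if the variances converge -/

theorem gaussianReal_real_Iic {σ : ℝ} (hσ : 0 < σ) (x : ℝ) :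
    (gaussianReal 0 (Real.toNNReal (σ ^ 2))).real (Set.Iic x) = stdNormalCDF (x / σ) := by
  have h := gaussianReal_map_const_mul (μ := 0) (v := 1) σ
  have e : NNReal.mk (σ ^ 2) (sq_nonneg σ) * 1 = Real.toNNReal (σ ^ 2) := by
    rw [mul_one, Real.toNNReal_of_nonneg (sq_nonneg σ)]
  rw [mul_zero, e] at h
  rw [← h, map_measureReal_apply (by fun_prop) measurableSet_Iic, stdNormalCDF]
  congr 1
  ext y
  simp only [Set.mem_preimage, Set.mem_Iic]
  rw [le_div_iff₀ hσ, mul_comm]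

theorem stdNormalCDF_nonneg (x : ℝ) : 0 ≤ stdNormalCDF x := measureReal_nonneg

theorem stdNormalCDF_le_one (x : ℝ) : stdNormalCDF x ≤ 1 := measureReal_le_one

theorem strictMono_stdNormalCDF : StrictMono stdNormalCDF := by
  intro a b hab
  have h : 0 < (gaussianReal 0 1).real (Set.Ioc a b) := by
    rw [measureReal_def, ENNReal.toReal_pos_iff]
    refine ⟨pos_iff_ne_zero.2 fun h0 => ?_, measure_lt_top _ _⟩
    have := gaussianReal_absolutelyContinuous' 0 (one_ne_zero (α := ℝ≥0)) h0
    rw [Real.volume_Ioc, ENNReal.ofReal_eq_zero] at this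
    linarith
  rw [← Set.Iic_sdiff_Iic, measureReal_sdiff (Set.Iic_subset_Iic.2 hab.le) measurableSet_Iic] at h
  exact sub_pos.1 h

theorem convCDF_nonneg (ν : Measure ℝ) (k : ℕ) (x : ℝ) : 0 ≤ convCDF ν k x := measureReal_nonneg

theorem convCDF_le_one (ν : Measure ℝ) [IsProbabilityMeasure ν] (k : ℕ) (x : ℝ) :
    convCDF ν k x ≤ 1 := measureReal_le_one

theorem abs_convCDF_sub_le_iSup (ν : Measure ℝ) [IsProbabilityMeasure ν] (k : ℕ) (σ x : ℝ) :
    |convCDF ν k x - stdNormalCDF (x / σ)| ≤ ⨆ x, |convCDF ν k x - stdNormalCDF (x / σ)| :=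
  le_ciSup (f := fun x => |convCDF ν k x - stdNormalCDF (x / σ)|)
    (bddAbove_range_abs_sub (convCDF_nonneg ν k) (convCDF_le_one ν k)
      (fun _ => stdNormalCDF_nonneg _) (fun _ => stdNormalCDF_le_one _)) x

theorem tendsto_iSup_convCDF_sub {ν : ℕ → Measure ℝ} [∀ n, IsProbabilityMeasure (ν n)]
    (hν : ∀ n, MemLp id 2 (ν n)) {k : ℕ → ℕ} (hk_pos : ∀ n, 0 < k n) (hk : Tendsto k atTop atTop)
    (htr : ∀ ε : ℝ, 0 < ε →
      Tendsto (fun n => truncSecondMoment (ν n) (√(k n : ℝ) * ε)) atTop (𝓝 0))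
    {σ : ℝ} (hσ : 0 < σ) (hvar : Tendsto (fun n => distVar (ν n)) atTop (𝓝 (σ ^ 2))) :
    Tendsto (fun n => ⨆ x, |convCDF (ν n) (k n) x - stdNormalCDF (x / σ)|) atTop (𝓝 0) := by
  have hv : Real.toNNReal (σ ^ 2) ≠ 0 := by
    rw [Ne, Real.toNNReal_eq_zero, not_le]; positivity
  have : NullSingletonClass (gaussianReal 0 (Real.toNNReal (σ ^ 2))) :=
    nullSingletonClass_gaussianReal hv
  have h : Tendsto (β := ProbabilityMeasure ℝ) (fun n => ⟨convLaw (ν n) (k n), inferInstance⟩)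
      atTop (𝓝 ⟨gaussianReal 0 (Real.toNNReal (σ ^ 2)), inferInstance⟩) := by
    refine ProbabilityMeasure.tendsto_of_tendsto_charFun fun t => ?_
    have := tendsto_charFun_convLaw hν hk_pos hk htr (t := fun _ => t)
      (Eventually.of_forall fun _ => le_refl |t|) (hvar.const_mul (t ^ 2))
    simp only [ProbabilityMeasure.coe_mk, charFun_gaussianReal]
    convert this using 2
    rw [Real.coe_toNNReal _ (sq_nonneg σ)]
    push_cast
    congr 1
    ring
  have h' := (tendsto_iff_tendsto_iSup_measureReal_Iic
    (ν := ⟨gaussianReal 0 (Real.toNNReal (σ ^ 2)), inferInstance⟩) this).1 h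
  simpa only [ProbabilityMeasure.coe_mk, gaussianReal_real_Iic hσ, convCDF] using h'

theorem tendsto_distVar_of_tendsto_iSup {ν : ℕ → Measure ℝ} [∀ n, IsProbabilityMeasure (ν n)]
    (hν : ∀ n, MemLp id 2 (ν n)) {k : ℕ → ℕ} (hk_pos : ∀ n, 0 < k n) (hk : Tendsto k atTop atTop)
    (htr : ∀ ε : ℝ, 0 < ε →
      Tendsto (fun n => truncSecondMoment (ν n) (√(k n : ℝ) * ε)) atTop (𝓝 0))
    {σ : ℝ} (hσ : 0 < σ)
    (hsup : Tendsto (fun n => ⨆ x, |convCDF (ν n) (k n) x - stdNormalCDF (x / σ)|) atTop (𝓝 0)) :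
    Tendsto (fun n => distVar (ν n)) atTop (𝓝 (σ ^ 2)) := by
  obtain ⟨s, hs⟩ : ∃ s : ℕ → ℝ, ∀ n, s n = √(distVar (ν n)) := ⟨_, fun _ => rfl⟩
  have hs2 : ∀ n, s n ^ 2 = distVar (ν n) := fun n => by
    rw [hs, Real.sq_sqrt (distVar_nonneg _)]
  have hs0 : ∀ n, 0 ≤ s n := fun n => by rw [hs]; exact Real.sqrt_nonneg _
  -- the variances are bounded away from zero
  obtain ⟨c, hc0, hc⟩ : ∃ c > 0, ∀ᶠ n in atTop, c ≤ s n := by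
    have hlt : stdNormalCDF (1 / σ) < 1 :=
      (strictMono_stdNormalCDF (lt_add_one (1 / σ))).trans_le (stdNormalCDF_le_one _)
    -- Half the limiting tail mass beyond 1: once `C_n` is within `d` of the limit, its own tail
    -- exceeds `d`, and Chebyshev gives variance at least `d`.
    obtain ⟨d, hd⟩ : ∃ d, d = (1 - stdNormalCDF (1 / σ)) / 2 := ⟨_, rfl⟩
    have hd0 : 0 < d := by rw [hd]; linarith
    refine ⟨√d, Real.sqrt_pos.2 hd0, ?_⟩
    filter_upwards [hsup.eventually_lt_const hd0] with n hn
    have h1 := one_sub_convCDF_one_le (hν n) (hk_pos n)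
    have h2 := (le_abs_self _).trans_lt ((abs_convCDF_sub_le_iSup (ν n) (k n) σ 1).trans_lt hn)
    rw [hs]
    exact Real.sqrt_le_sqrt (by linarith)
  have hpos : ∀ᶠ n in atTop, 0 < s n := hc.mono fun n hn => hc0.trans_le hn
  have hprob : ∀ n, IsProbabilityMeasure ((convLaw (ν n) (k n)).map fun x => (s n)⁻¹ * x) :=
    fun n => Measure.isProbabilityMeasure_map (by fun_prop)
  have hnull : NullSingletonClass (gaussianReal 0 1) := nullSingletonClass_gaussianReal one_ne_zero
  have h : Tendsto (β := ProbabilityMeasure ℝ)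
      (fun n => ⟨(convLaw (ν n) (k n)).map fun x => (s n)⁻¹ * x, hprob n⟩)
      atTop (𝓝 ⟨gaussianReal 0 1, inferInstance⟩) := by
    refine ProbabilityMeasure.tendsto_of_tendsto_charFun fun t => ?_
    simp only [ProbabilityMeasure.coe_mk, charFun_map_mul, charFun_gaussianReal]
    -- The lower bound on `s n` keeps the arguments bounded; no upper bound on the variances is
    -- needed, since they enter only through the product in `hvv`.
    have hb : ∀ᶠ n in atTop, |(s n)⁻¹ * t| ≤ c⁻¹ * |t| := by
      filter_upwards [hc] with n hn
      rw [abs_mul, abs_of_nonneg (inv_nonneg.2 (hs0 n))]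
      gcongr
    have hvv : Tendsto (fun n => ((s n)⁻¹ * t) ^ 2 * distVar (ν n)) atTop (𝓝 (t ^ 2)) := by
      refine tendsto_const_nhds.congr' ?_
      filter_upwards [hpos] with n hn
      rw [← hs2]
      field_simp
    convert tendsto_charFun_convLaw hν hk_pos hk htr hb hvv using 2
    push_cast
    congr 1
    simp
  have h1 : Tendsto (fun n => convCDF (ν n) (k n) (s n)) atTop (𝓝 (stdNormalCDF 1)) := by
    refine (tendsto_measureReal_Iic (ν := ⟨gaussianReal 0 1, inferInstance⟩) hnull h 1).congr' ?_
    filter_upwards [hpos] with n hn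
    simp only [ProbabilityMeasure.coe_mk, convCDF]
    rw [map_measureReal_apply (by fun_prop) measurableSet_Iic]
    congr 1
    ext y
    simp only [Set.mem_preimage, Set.mem_Iic]
    rw [inv_mul_le_iff₀ hn, mul_one]
  have h2 : Tendsto (fun n => stdNormalCDF (s n / σ)) atTop (𝓝 (stdNormalCDF 1)) := by
    have h3 : Tendsto (fun n => convCDF (ν n) (k n) (s n) - stdNormalCDF (s n / σ)) atTop (𝓝 0) :=
      squeeze_zero_norm (fun n => abs_convCDF_sub_le_iSup (ν n) (k n) σ (s n)) hsup
    simpa using h1.sub h3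
  have h4 : Tendsto (fun n => s n / σ) atTop (𝓝 1) := by
    rw [tendsto_order]
    constructor
    · intro a ha
      filter_upwards [h2.eventually_const_lt (strictMono_stdNormalCDF ha)] with n hn
      exact strictMono_stdNormalCDF.lt_iff_lt.1 hn
    · intro a ha
      filter_upwards [h2.eventually_lt_const (strictMono_stdNormalCDF ha)] with n hn
      exact strictMono_stdNormalCDF.lt_iff_lt.1 hn
  have h5 := (h4.mul_const σ).pow 2
  rw [one_mul] at h5
  refine h5.congr fun n => ?_
  rw [div_mul_cancel₀ _ hσ.ne', hs2]


/-! ### From deterministic sequences to convergence in probability -/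

/-- An implication between limits along all deterministic Lindeberg sequences holds uniformly. -/
theorem exists_delta_of_forall_seq {f g : Measure ℝ → ℕ → ℝ}
    (hfg : ∀ (ν : ℕ → Measure ℝ) (k : ℕ → ℕ), (∀ n, IsProbabilityMeasure (ν n)) →
      (∀ n, MemLp id 2 (ν n)) → (∀ n, 0 < k n) → Tendsto k atTop atTop →
      (∀ ε : ℝ, 0 < ε →
        Tendsto (fun n => truncSecondMoment (ν n) (√(k n : ℝ) * ε)) atTop (𝓝 0)) →
      Tendsto (fun n => f (ν n) (k n)) atTop (𝓝 0) → Tendsto (fun n => g (ν n) (k n)) atTop (𝓝 0))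
    {η : ℝ} (hη : 0 < η) :
    ∃ δ > 0, ∃ K : ℕ, ∀ (ν : Measure ℝ) (k : ℕ), IsProbabilityMeasure ν → MemLp id 2 ν →
      0 < k → K ≤ k → truncSecondMoment ν (√(k : ℝ) * δ) < δ → |f ν k| < δ → |g ν k| < η := by
  -- Counterexamples at `δ = 1 / (j + 1)`, `K = j` assemble into one Lindeberg sequence with `f → 0`
  -- but `|g| ≥ η` throughout. As `δ` is also the truncation level, antitonicity in the level
  -- recovers every fixed `ε`.
  by_contra! hcon
  have hδ : ∀ j : ℕ, (0 : ℝ) < 1 / ((j : ℝ) + 1) := fun j => Nat.one_div_pos_of_nat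
  choose ν k hprob hmem hpos hK htr hf hg using fun j : ℕ => hcon (1 / ((j : ℝ) + 1)) (hδ j) j
  have hk : Tendsto k atTop atTop := tendsto_atTop_mono hK tendsto_id
  have hg0 : Tendsto (fun n => g (ν n) (k n)) atTop (𝓝 0) := by
    refine hfg ν k hprob hmem hpos hk (fun ε hε => ?_) ?_
    · refine squeeze_zero' (Eventually.of_forall fun n => truncSecondMoment_nonneg _ _) ?_
        tendsto_one_div_add_atTop_nhds_zero_nat
      filter_upwards [tendsto_one_div_add_atTop_nhds_zero_nat.eventually_lt_const hε] with n hn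
      exact (truncSecondMoment_anti (hmem n)
        (mul_le_mul_of_nonneg_left hn.le (Real.sqrt_nonneg _))).trans (htr n).le
    · exact squeeze_zero_norm (fun n => (hf n).le) tendsto_one_div_add_atTop_nhds_zero_nat
  have h0 := hg0.abs
  rw [abs_zero] at h0
  obtain ⟨n, hn⟩ := (h0.eventually_lt_const hη).exists
  exact absurd hn (not_lt.2 (hg n))

/-- Off two events of vanishing probability the uniform δ-implication applies at each `ω`
separately. Only monotonicity and subadditivity of `P` are used, so no measurability of `ω ↦ ν n ω`
is needed. -/
theorem tendstoInMeasure_of_forall_seq {Ω : Type*} [MeasurableSpace Ω] {P : Measure Ω}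
    {f g : Measure ℝ → ℕ → ℝ}
    (hfg : ∀ (ν : ℕ → Measure ℝ) (k : ℕ → ℕ), (∀ n, IsProbabilityMeasure (ν n)) →
      (∀ n, MemLp id 2 (ν n)) → (∀ n, 0 < k n) → Tendsto k atTop atTop →
      (∀ ε : ℝ, 0 < ε →
        Tendsto (fun n => truncSecondMoment (ν n) (√(k n : ℝ) * ε)) atTop (𝓝 0)) →
      Tendsto (fun n => f (ν n) (k n)) atTop (𝓝 0) → Tendsto (fun n => g (ν n) (k n)) atTop (𝓝 0))
    {ν : ℕ → Ω → Measure ℝ} (hprob : ∀ n ω, IsProbabilityMeasure (ν n ω))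
    (hν : ∀ n ω, MemLp id 2 (ν n ω)) {k : ℕ → ℕ} (hk_pos : ∀ n, 0 < k n)
    (hk : Tendsto k atTop atTop)
    (htr : ∀ ε : ℝ, 0 < ε → TendstoInMeasure P
      (fun n ω => truncSecondMoment (ν n ω) (√(k n : ℝ) * ε)) atTop (fun _ => (0 : ℝ)))
    (hf : TendstoInMeasure P (fun n ω => f (ν n ω) (k n)) atTop (fun _ => (0 : ℝ))) :
    TendstoInMeasure P (fun n ω => g (ν n ω) (k n)) atTop (fun _ => (0 : ℝ)) := by
  simp only [tendstoInMeasure_iff_norm, sub_zero, Real.norm_eq_abs] at htr hf ⊢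
  intro η hη
  obtain ⟨δ, hδ, K, hδK⟩ := exists_delta_of_forall_seq hfg hη
  have hsum := (htr δ hδ δ hδ).add (hf δ hδ)
  rw [add_zero] at hsum
  refine tendsto_of_tendsto_of_tendsto_of_le_of_le' tendsto_const_nhds hsum
    (Eventually.of_forall fun _ => zero_le) ?_
  filter_upwards [hk.eventually_ge_atTop K] with n hn
  refine (measure_mono fun ω hω => ?_).trans (measure_union_le _ _)
  by_contra hcon
  simp only [Set.mem_union, Set.mem_ofPred_eq, not_or, not_le] at hcon hω
  exact absurd (hδK (ν n ω) (k n) (hprob n ω) (hν n ω) (hk_pos n) hn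
    ((le_abs_self _).trans_lt hcon.1) hcon.2) (not_lt.2 hω)

/-- If `g` is within an error vanishing in probability of a deterministic sequence `c`, then `g`
vanishes in probability exactly when `c` tends to zero. -/
theorem tendstoInMeasure_zero_iff_of_abs_sub_le {Ω : Type*} [MeasurableSpace Ω] {P : Measure Ω}
    [IsProbabilityMeasure P] {f g : ℕ → Ω → ℝ} {c : ℕ → ℝ}
    (hf : TendstoInMeasure P f atTop (fun _ => (0 : ℝ))) (h : ∀ n ω, |g n ω - c n| ≤ f n ω) :
    TendstoInMeasure P g atTop (fun _ => (0 : ℝ)) ↔ Tendsto c atTop (𝓝 0) := by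
  simp only [tendstoInMeasure_iff_norm, sub_zero, Real.norm_eq_abs] at hf ⊢
  constructor
  · intro hg
    rw [Metric.tendsto_nhds]
    intro ε hε
    have hsum := (hg (ε / 2) (half_pos hε)).add (hf (ε / 2) (half_pos hε))
    rw [add_zero] at hsum
    -- When the two bad events have total probability below 1, some `ω` avoids both, and the
    -- deterministic bound on `c n` is read off there.
    filter_upwards [hsum.eventually_lt_const one_pos] with n hn
    rw [dist_zero_right, Real.norm_eq_abs]
    by_contra! hcon
    refine absurd hn (not_lt.2 ?_)
    rw [← measure_univ (μ := P)]
    refine (measure_mono fun ω _ => ?_).trans (measure_union_le _ _)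
    by_contra! hω
    simp only [Set.mem_union, Set.mem_ofPred_eq, not_or, not_le] at hω
    have h1 := abs_sub_abs_le_abs_sub (c n) (g n ω)
    rw [abs_sub_comm] at h1
    linarith [h n ω, le_abs_self (f n ω)]
  · intro hc ε hε
    have hc' := hc.abs
    rw [abs_zero] at hc'
    refine tendsto_of_tendsto_of_tendsto_of_le_of_le' tendsto_const_nhds (hf (ε / 2) (half_pos hε))
      (Eventually.of_forall fun _ => zero_le) ?_
    filter_upwards [hc'.eventually_lt_const (half_pos hε)] with n hn
    refine measure_mono fun ω hω => ?_
    simp only [Set.mem_ofPred_eq] at hω ⊢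
    have h1 := abs_sub_abs_le_abs_sub (g n ω) (c n)
    linarith [h n ω, le_abs_self (f n ω)]

theorem abs_iSup_abs_sub_sub_iSup_abs_sub_le {F G H : ℝ → ℝ}
    (hF0 : ∀ x, 0 ≤ F x) (hF1 : ∀ x, F x ≤ 1) (hG0 : ∀ x, 0 ≤ G x) (hG1 : ∀ x, G x ≤ 1)
    (hH0 : ∀ x, 0 ≤ H x) (hH1 : ∀ x, H x ≤ 1) :
    |(⨆ x, |F x - G x|) - (⨆ x, |G x - H x|)| ≤ ⨆ x, |F x - H x| := by
  have bFG := bddAbove_range_abs_sub hF0 hF1 hG0 hG1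
  have bGH := bddAbove_range_abs_sub hG0 hG1 hH0 hH1
  have bFH := bddAbove_range_abs_sub hF0 hF1 hH0 hH1
  rw [abs_sub_le_iff, sub_le_iff_le_add, sub_le_iff_le_add]
  constructor <;> refine ciSup_le fun x => ?_
  · have h1 := le_ciSup bFH x
    have h2 := le_ciSup bGH x
    have h3 := abs_sub_le (F x) (H x) (G x)
    rw [abs_sub_comm (H x)] at h3
    linarith
  · have h1 := le_ciSup bFH x
    have h2 := le_ciSup bFG x
    have h3 := abs_sub_le (G x) (F x) (H x)
    rw [abs_sub_comm (G x) (F x)] at h3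
    linarith

/-! ### The subsampling distribution and the target statistic -/

section Subsampling

variable {Ω : Type*} (t : (m : ℕ) → (Fin m → ℝ) → ℝ) (τ : ℕ → ℝ) (b : ℕ → ℕ) (X : ℕ → Ω → ℝ)

/-- The block count `n - b n + 1` is positive even where natural subtraction truncates, so this
holds for every `n`. -/
theorem isProbabilityMeasure_subDist (n : ℕ) (ω : Ω) :
    IsProbabilityMeasure (subDist t τ b X n ω) := by
  refine ⟨?_⟩
  simp only [subDist, Measure.smul_apply, Measure.finsetSum_apply, measure_univ, smul_eq_mul,
    Finset.sum_const, Nat.card_Icc, add_tsub_cancel_right, nsmul_eq_mul, mul_one]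
  exact ENNReal.inv_mul_cancel (Nat.cast_ne_zero.2 (Nat.succ_ne_zero _)) (ENNReal.natCast_ne_top _)

theorem memLp_subDist (n : ℕ) (ω : Ω) : MemLp id 2 (subDist t τ b X n ω) := by
  rw [memLp_two_iff_integrable_sq (by fun_prop), subDist]
  refine Integrable.smul_measure ?_
    (ENNReal.inv_ne_top.2 (Nat.cast_ne_zero.2 (Nat.succ_ne_zero _)))
  rw [integrable_finsetSum_measure]
  exact fun i _ => integrable_dirac enorm_lt_top

theorem measurable_targetStat [MeasurableSpace Ω] {t : (m : ℕ) → (Fin m → ℝ) → ℝ}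
    (ht : ∀ m, Measurable (t m)) {X : ℕ → Ω → ℝ} (hX : ∀ i, Measurable (X i)) (θ : ℝ) (n : ℕ) :
    Measurable (targetStat t τ θ X n) := by
  have : Measurable (fullStat t X n) :=
    (ht n).comp (measurable_pi_lambda _ fun j => hX _)
  exact (this.sub_const θ).const_mul (τ n)

theorem tendstoInDistribution_targetStat_iff [MeasurableSpace Ω] (P : Measure Ω)
    [IsProbabilityMeasure P] {t : (m : ℕ) → (Fin m → ℝ) → ℝ} (ht : ∀ m, Measurable (t m))
    {X : ℕ → Ω → ℝ} (hX : ∀ i, Measurable (X i)) (θ : ℝ) {σ : ℝ} (hσ : 0 < σ) :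
    TendstoInDistribution (fun n => targetStat t τ θ X n) atTop (id : ℝ → ℝ) (fun _ => P)
        (gaussianReal 0 (Real.toNNReal (σ ^ 2))) ↔
      Tendsto (fun n => ⨆ x : ℝ, |targetCDF P t τ θ X n x - stdNormalCDF (x / σ)|) atTop (𝓝 0) := by
  have hv : Real.toNNReal (σ ^ 2) ≠ 0 := by
    rw [Ne, Real.toNNReal_eq_zero, not_le]; positivity
  have hm := measurable_targetStat τ ht hX θ
  have hprob : ∀ n, IsProbabilityMeasure (P.map (targetStat t τ θ X n)) :=
    fun n => Measure.isProbabilityMeasure_map (hm n).aemeasurable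
  have hcdf : ∀ n x, (P.map (targetStat t τ θ X n)).real (Set.Iic x) = targetCDF P t τ θ X n x :=
    fun n x => map_measureReal_apply (hm n) measurableSet_Iic
  have key := tendsto_iff_tendsto_iSup_measureReal_Iic
    (μ := fun n => ⟨P.map (targetStat t τ θ X n), hprob n⟩)
    (ν := ⟨gaussianReal 0 (Real.toNNReal (σ ^ 2)), inferInstance⟩)
    (nullSingletonClass_gaussianReal hv)
  simp only [ProbabilityMeasure.coe_mk, gaussianReal_real_Iic hσ, hcdf] at key
  rw [← key]
  have hid : (⟨(gaussianReal 0 (Real.toNNReal (σ ^ 2))).map id,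
      Measure.isProbabilityMeasure_map aemeasurable_id⟩ : ProbabilityMeasure ℝ)
      = ⟨gaussianReal 0 (Real.toNNReal (σ ^ 2)), inferInstance⟩ := Subtype.ext Measure.map_id
  rw [← hid]
  exact ⟨fun h => h.tendsto, fun h => ⟨fun n => (hm n).aemeasurable, aemeasurable_id, h⟩⟩

end Subsampling

end ConvSub

theorem theorem2 {Ω : Type*} [MeasurableSpace Ω] (P : Measure Ω) [IsProbabilityMeasure P]
    (X : ℕ → Ω → ℝ) (hX : ∀ i, Measurable (X i))
    (t : (m : ℕ) → (Fin m → ℝ) → ℝ) (ht : ∀ m, Measurable (t m))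
    (θ : ℝ) (τ : ℕ → ℝ) (hτ : ∀ n, 0 < τ n)
    (b : ℕ → ℕ) (hb : ∀ᶠ n in atTop, 1 ≤ b n ∧ b n < n)
    (k : ℕ → ℕ) (hk_pos : ∀ n, 0 < k n) (hk : Tendsto k atTop atTop)
    (htrunc : ∀ ε : ℝ, 0 < ε →
      TendstoInMeasure P
        (fun n ω => ConvSub.truncSecondMoment (ConvSub.subDist t τ b X n ω) (√(k n : ℝ) * ε))
        atTop (fun _ => (0 : ℝ)))
    (σ : ℝ) (hσ : 0 < σ) :
    -- (i)
    (TendstoInMeasure P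
        (fun n ω => ⨆ x : ℝ, |ConvSub.convCDF (ConvSub.subDist t τ b X n ω) (k n) x
          - ConvSub.stdNormalCDF (x / σ)|) atTop (fun _ => (0 : ℝ))
      ↔ TendstoInMeasure P
        (fun n ω => ConvSub.distVar (ConvSub.subDist t τ b X n ω)) atTop (fun _ => σ ^ 2)) ∧
    -- (ii)
    (TendstoInMeasure P
        (fun n ω => ConvSub.distVar (ConvSub.subDist t τ b X n ω)) atTop (fun _ => σ ^ 2) →
      (TendstoInMeasure P
          (fun n ω => ⨆ x : ℝ, |ConvSub.convCDF (ConvSub.subDist t τ b X n ω) (k n) x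
            - ConvSub.targetCDF P t τ θ X n x|) atTop (fun _ => (0 : ℝ))
        ↔ TendstoInDistribution (fun n => ConvSub.targetStat t τ θ X n) atTop
            (id : ℝ → ℝ) (fun _ => P) (gaussianReal 0 (Real.toNNReal (σ ^ 2)))) ∧
      (TendstoInMeasure P
          (fun n ω => ⨆ x : ℝ, |ConvSub.convCDF (ConvSub.subDist t τ b X n ω) (k n) x
            - ConvSub.targetCDF P t τ θ X n x|) atTop (fun _ => (0 : ℝ))
        ↔ Tendsto
            (fun n => ⨆ x : ℝ, |ConvSub.targetCDF P t τ θ X n x - ConvSub.stdNormalCDF (x / σ)|)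
            atTop (𝓝 0))) := by
  have hprob := ConvSub.isProbabilityMeasure_subDist t τ b X
  have hmem := ConvSub.memLp_subDist t τ b X
  -- The transfer lemma is phrased for limits equal to zero, so the variance is shifted by `σ²`.
  have hvar : TendstoInMeasure P
      (fun n ω => ConvSub.distVar (ConvSub.subDist t τ b X n ω)) atTop (fun _ => σ ^ 2) ↔
      TendstoInMeasure P
      (fun n ω => ConvSub.distVar (ConvSub.subDist t τ b X n ω) - σ ^ 2) atTop
        (fun _ => (0 : ℝ)) := by
    simp only [tendstoInMeasure_iff_norm, sub_zero]
  have hi : TendstoInMeasure P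
        (fun n ω => ⨆ x : ℝ, |ConvSub.convCDF (ConvSub.subDist t τ b X n ω) (k n) x
          - ConvSub.stdNormalCDF (x / σ)|) atTop (fun _ => (0 : ℝ))
      ↔ TendstoInMeasure P
        (fun n ω => ConvSub.distVar (ConvSub.subDist t τ b X n ω)) atTop (fun _ => σ ^ 2) := by
    rw [hvar]
    constructor
    · refine ConvSub.tendstoInMeasure_of_forall_seq
        (f := fun ν k => ⨆ x : ℝ, |ConvSub.convCDF ν k x - ConvSub.stdNormalCDF (x / σ)|)
        (g := fun ν _ => ConvSub.distVar ν - σ ^ 2) ?_ hprob hmem hk_pos hk htrunc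
      intro ν k hν hν2 hk0 hk1 htr h
      exact tendsto_sub_nhds_zero_iff.2
        (ConvSub.tendsto_distVar_of_tendsto_iSup hν2 hk0 hk1 htr hσ h)
    · refine ConvSub.tendstoInMeasure_of_forall_seq
        (f := fun ν _ => ConvSub.distVar ν - σ ^ 2)
        (g := fun ν k => ⨆ x : ℝ, |ConvSub.convCDF ν k x - ConvSub.stdNormalCDF (x / σ)|)
        ?_ hprob hmem hk_pos hk htrunc
      intro ν k hν hν2 hk0 hk1 htr h
      exact ConvSub.tendsto_iSup_convCDF_sub hν2 hk0 hk1 htr hσ (tendsto_sub_nhds_zero_iff.1 h)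
  refine ⟨hi, fun h => ?_⟩
  have hii := ConvSub.tendstoInMeasure_zero_iff_of_abs_sub_le (hi.2 h)
    (g := fun n ω => ⨆ x : ℝ, |ConvSub.convCDF (ConvSub.subDist t τ b X n ω) (k n) x
      - ConvSub.targetCDF P t τ θ X n x|)
    (c := fun n => ⨆ x : ℝ, |ConvSub.targetCDF P t τ θ X n x - ConvSub.stdNormalCDF (x / σ)|)
    fun n ω => ConvSub.abs_iSup_abs_sub_sub_iSup_abs_sub_le
      (ConvSub.convCDF_nonneg _ _)
      (haveI := hprob n ω; ConvSub.convCDF_le_one (ConvSub.subDist t τ b X n ω) (k n))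
      (fun _ => measureReal_nonneg) (fun _ => measureReal_le_one)
      (fun _ => ConvSub.stdNormalCDF_nonneg _) (fun _ => ConvSub.stdNormalCDF_le_one _)
  exact ⟨hii.trans (ConvSub.tendstoInDistribution_targetStat_iff τ P ht hX θ hσ).symm, hii⟩
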